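/- Let $n\ge 2$ and consider $n$ qubits on an open line. Write $X_q,Y_q,Z_q$ for the Pauli matrices acting on qubit $q$, $R^z_q(\theta)=e^{i\theta Z_q/2}$ for $1\le q\le n$, and $R^{xx}_{q,q+1}(\theta)=e^{i\theta X_qX_{q+1}/2}$ for $1\le q\le n-1$. Let the $n$-qubit matchgate group $\mathcal M_n\subset \mathbb U(2^n)$ be the group generated by all $R^z_q(\theta)$ and all $R^{xx}_{q,q+1}(\theta)$ with $\theta\in\mathbb R$, and put $\overline T_q=R^z_q(\pi/4)$, $\overline S_q=R^z_q(\pi/2)$. Then the gate set $$\mathcal G=\{\overline T_q,\overline S_q\}_{q=1}^{n}\cup\{R^{xx}_{q,q+1}(\pi/2)\}_{q=1}^{n-1}$$ is universal for matchgates: the group $\langle\mathcal G\rangle$ generated by $\mathcal G$ is a dense subgroup of $\mathcal M_n$, i.e. $\langle\mathcal G\rangle\subseteq\mathcal M_n$ and for every $U\in\mathcal M_n$ and $\varepsilon>0$ there is $V\in\langle\mathcal G\rangle$ with $\|U-V\|<\varepsilon$ in operator norm. In particular, the matchgate-Clifford group (the intersection of $\mathcal M_n$ with the $n$-qubit Clifford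 group, that is, the normalizer in $\mathbb U(2^n)$ of the group of Pauli strings with phases $\pm1,\pm i$) together with the gates $\overline T_q$, $1\le q\le n$, also generates a dense subgroup of $\mathcal M_n$. -/

import Mathlib

open scoped Matrix.Norms.L2Operator

namespace Matchgate

noncomputable section

/-- Matrices acting on `n` qubits, in the computational basis `|x_1 … x_n⟩`, `x : Fin n → Fin 2`. -/
abbrev QMat (n : ℕ) : Type := Matrix (Fin n → Fin 2) (Fin n → Fin 2) ℂ

/-- The unitary group `U(2^n)` of `n` qubits. -/
abbrev QUnitary (n : ℕ) : Type := Matrix.unitaryGroup (Fin n → Fin 2) ℂ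

/-- The Pauli matrix `X`. -/
def pauliX : Matrix (Fin 2) (Fin 2) ℂ := !![0, 1; 1, 0]

/-- The Pauli matrix `Y`. -/
def pauliY : Matrix (Fin 2) (Fin 2) ℂ := !![0, -Complex.I; Complex.I, 0]

/-- The Pauli matrix `Z`. -/
def pauliZ : Matrix (Fin 2) (Fin 2) ℂ := !![1, 0; 0, -1]

/-- The tensor product `A_1 ⊗ ⋯ ⊗ A_n` of single-qubit matrices. -/
def tensor {n : ℕ} (A : Fin n → Matrix (Fin 2) (Fin 2) ℂ) : QMat n :=
  Matrix.of fun x y => ∏ q, A q (x q) (y q)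

/-- The single-qubit matrix `A` acting on qubit `q`, with the identity on all other qubits. -/
def onQubit {n : ℕ} (q : Fin n) (A : Matrix (Fin 2) (Fin 2) ℂ) : QMat n :=
  tensor fun i => if i = q then A else 1

/-- `Z_q`. -/
def Zop {n : ℕ} (q : Fin n) : QMat n := onQubit q pauliZ

/-- `X_q X_r`, that is, `X` on qubit `q` and `X` on qubit `r` (used for `q ≠ r`). -/
def XXop {n : ℕ} (q r : Fin n) : QMat n :=
  tensor fun i => if i = q ∨ i = r then pauliX else 1

theorem tensor_isHermitian {n : ℕ} {A : Fin n → Matrix (Fin 2) (Fin 2) ℂ}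
    (hA : ∀ q, (A q).IsHermitian) : (tensor A).IsHermitian := by
  ext x y
  simp only [tensor, Matrix.conjTranspose_apply, Matrix.of_apply, star_prod]
  exact Finset.prod_congr rfl fun q _ => (hA q).apply _ _

theorem pauliX_isHermitian : pauliX.IsHermitian := by
  ext i j
  fin_cases i <;> fin_cases j <;> simp [pauliX]

theorem pauliZ_isHermitian : pauliZ.IsHermitian := by
  ext i j
  fin_cases i <;> fin_cases j <;> simp [pauliZ]

theorem Zop_isHermitian {n : ℕ} (q : Fin n) : (Zop q).IsHermitian := by
  refine tensor_isHermitian fun i => ?_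
  by_cases h : i = q
  · simpa [h] using pauliZ_isHermitian
  · simp [h]

theorem XXop_isHermitian {n : ℕ} (q r : Fin n) : (XXop q r).IsHermitian := by
  refine tensor_isHermitian fun i => ?_
  by_cases h : i = q ∨ i = r
  · simpa [h] using pauliX_isHermitian
  · simp [h]

theorem exp_rotation_mem {n : ℕ} {H : QMat n} (hH : H.IsHermitian) (θ : ℝ) :
    NormedSpace.exp ((Complex.I * (θ / 2 : ℝ)) • H) ∈
      Matrix.unitaryGroup (Fin n → Fin 2) ℂ := by
  let _ : NormedAlgebra ℚ (QMat n) := NormedAlgebra.restrictScalars ℚ ℂ (QMat n)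
  apply NormedSpace.exp_mem_unitary_of_mem_skewAdjoint
  rw [skewAdjoint.mem_iff, star_smul, Matrix.star_eq_conjTranspose, hH.eq]
  simp

/-- The rotation `exp(i θ H / 2)` generated by a Hermitian matrix `H`. -/
def hermRotation {n : ℕ} (H : QMat n) (hH : H.IsHermitian) (θ : ℝ) : QUnitary n :=
  ⟨NormedSpace.exp ((Complex.I * (θ / 2 : ℝ)) • H), exp_rotation_mem hH θ⟩

/-- `R^z_q(θ) = exp(i θ Z_q / 2)`. -/
def Rz {n : ℕ} (q : Fin n) (θ : ℝ) : QUnitary n := hermRotation (Zop q) (Zop_isHermitian q) θ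

/-- `R^{xx}_{q,r}(θ) = exp(i θ X_q X_r / 2)`. -/
def Rxx {n : ℕ} (q r : Fin n) (θ : ℝ) : QUnitary n :=
  hermRotation (XXop q r) (XXop_isHermitian q r) θ

/-- `T̄_q = R^z_q(π/4)`. -/
def Tbar {n : ℕ} (q : Fin n) : QUnitary n := Rz q (Real.pi / 4)

/-- `S̄_q = R^z_q(π/2)`. -/
def Sbar {n : ℕ} (q : Fin n) : QUnitary n := Rz q (Real.pi / 2)

/-- The matchgate group on an open line of `n` qubits: the group generated by all `R^z_q(θ)` and
all nearest-neighbour `R^{xx}_{q,q+1}(θ)`. -/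
def matchgateGroup (n : ℕ) : Subgroup (QUnitary n) :=
  Subgroup.closure
    ({U | ∃ (q : Fin n) (θ : ℝ), U = Rz q θ} ∪
      {U | ∃ (q r : Fin n) (θ : ℝ), q.val + 1 = r.val ∧ U = Rxx q r θ})

/-- The finite gate set consisting of `T̄_q` and `S̄_q` on every qubit and of
`R^{xx}_{q,q+1}(π/2)` on every nearest-neighbour pair. -/
def gateSet (n : ℕ) : Set (QUnitary n) :=
  {U | ∃ q : Fin n, U = Tbar q ∨ U = Sbar q} ∪
    {U | ∃ q r : Fin n, q.val + 1 = r.val ∧ U = Rxx q r (Real.pi / 2)}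

/-- The Pauli group: Pauli strings with a phase `±1, ±i`. -/
def pauliGroup (n : ℕ) : Set (QUnitary n) :=
  {U | ∃ (k : ℕ) (P : Fin n → Matrix (Fin 2) (Fin 2) ℂ),
    (∀ q, P q = 1 ∨ P q = pauliX ∨ P q = pauliY ∨ P q = pauliZ) ∧
      (U : QMat n) = Complex.I ^ k • tensor P}

/-- The Clifford group: the normalizer of the Pauli group in the unitary group. -/
def cliffordGroup (n : ℕ) : Subgroup (QUnitary n) := Subgroup.normalizer (pauliGroup n)

/-- The matchgate-Clifford group: matchgate unitaries that are Clifford. -/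
def matchgateCliffordGroup (n : ℕ) : Subgroup (QUnitary n) := matchgateGroup n ⊓ cliffordGroup n

/-- The group generated by the gates in `G` is a dense subgroup of `M`: it is contained in `M`, and
approximates every element of `M` arbitrarily well in the operator norm (on `ℂ^(2^n)` with its
Euclidean norm). -/
def GeneratesDenseSubgroup {n : ℕ} (G : Set (QUnitary n)) (M : Subgroup (QUnitary n)) : Prop :=
  Subgroup.closure G ≤ M ∧
    ∀ U ∈ M, ∀ ε : ℝ, 0 < ε → ∃ V ∈ Subgroup.closure G, ‖(U : QMat n) - (V : QMat n)‖ < ε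

end

end Matchgate

namespace Matchgate

/-! ### Rotations generated by Hermitian matrices -/

section Rotation

variable {n : ℕ} {H : QMat n}

/-! It suffices that a closed subgroup `K` containing the gates contains every rotation about `A =
Z_p` and `B = X_q X_{q+1}`, where `p` is `q` or `q+1`. These are anticommuting involutions, so `A`,
`B` and `iAB` behave like the axes of a single-qubit rotation group
(`hermRotation_mem_of_anticommute`). Quarter turns carry the π/4 rotation from `A` to `B`. The
product of the two π/4 rotations is a rotation about a third axis `N` by an angle incommensurable
with π, because 1 + √2/2 is not an algebraic integer. Closedness then gives all rotations about `N`
and about its image `N'` under the half turn about `A`. Since `N + N'` is a multiple of `A`, the Lie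
product formula yields all rotations about `A`. For the Clifford version, the π/2 rotation about a
Pauli string maps Pauli strings to Pauli strings up to phase. -/

theorem coe_hermRotation (hH : H.IsHermitian) (θ : ℝ) :
    (hermRotation H hH θ : QMat n) = NormedSpace.exp ((Complex.I * (θ / 2 : ℝ)) • H) := rfl

theorem hermRotation_congr {H' : QMat n} (hH : H.IsHermitian) (hH' : H'.IsHermitian)
    (h : H = H') (θ : ℝ) : hermRotation H hH θ = hermRotation H' hH' θ := by
  subst h; rfl

theorem hermRotation_add (hH : H.IsHermitian) (θ φ : ℝ) :
    hermRotation H hH (θ + φ) = hermRotation H hH θ * hermRotation H hH φ := by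
  let _ : NormedAlgebra ℚ (QMat n) := NormedAlgebra.restrictScalars ℚ ℂ (QMat n)
  apply Subtype.ext
  rw [Submonoid.coe_mul]
  simp only [coe_hermRotation]
  rw [← NormedSpace.exp_add_of_commute (((Commute.refl H).smul_left _).smul_right _), ← add_smul]
  congr 2
  push_cast
  ring

theorem hermRotation_zero (hH : H.IsHermitian) : hermRotation H hH 0 = 1 := by
  apply Subtype.ext
  simp [coe_hermRotation]

theorem hermRotation_neg (hH : H.IsHermitian) (θ : ℝ) :
    hermRotation H hH (-θ) = (hermRotation H hH θ)⁻¹ := by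
  rw [eq_inv_iff_mul_eq_one, ← hermRotation_add, neg_add_cancel, hermRotation_zero]

theorem hermRotation_smul (hH : H.IsHermitian) (r : ℝ) (hrH : ((r : ℂ) • H).IsHermitian) (θ : ℝ) :
    hermRotation ((r : ℂ) • H) hrH θ = hermRotation H hH (r * θ) := by
  apply Subtype.ext
  simp only [coe_hermRotation, smul_smul]
  congr 2
  push_cast
  ring

theorem hermRotation_conj (hH : H.IsHermitian) (U : QUnitary n) {H' : QMat n}
    (hH' : H'.IsHermitian) (h : (U : QMat n) * H = H' * U) (θ : ℝ) :
    U * hermRotation H hH θ * U⁻¹ = hermRotation H' hH' θ := by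
  have hU : (U : QMat n) * star (U : QMat n) = 1 := Unitary.mul_star_self_of_mem U.2
  have hU' : star (U : QMat n) * (U : QMat n) = 1 := Unitary.star_mul_self_of_mem U.2
  let u : (QMat n)ˣ := ⟨U, star (U : QMat n), hU, hU'⟩
  have h' : H' = (u : QMat n) * H * ((u⁻¹ : (QMat n)ˣ) : QMat n) := by
    change H' = (U : QMat n) * H * star (U : QMat n)
    rw [h, mul_assoc, hU, mul_one]
  apply Subtype.ext
  rw [coe_hermRotation, h', ← smul_mul_assoc, ← mul_smul_comm, Matrix.exp_units_conj]
  rfl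

theorem hasDerivAt_hermRotation_zero (hH : H.IsHermitian) :
    HasDerivAt (fun θ : ℝ => (hermRotation H hH θ : QMat n)) ((Complex.I / 2) • H) 0 := by
  have h := hasDerivAt_exp_smul_const (𝕂 := ℝ) ((Complex.I / 2) • H) (0 : ℝ)
  simp only [zero_smul, NormedSpace.exp_zero, one_mul] at h
  refine h.congr_of_eventuallyEq (Filter.Eventually.of_forall fun θ => ?_)
  simp only [coe_hermRotation]
  congr 1
  rw [← Complex.coe_smul, smul_smul]
  congr 1
  push_cast
  ring

theorem continuous_hermRotation (hH : H.IsHermitian) : Continuous (hermRotation H hH) := by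
  let _ : NormedAlgebra ℚ (QMat n) := NormedAlgebra.restrictScalars ℚ ℂ (QMat n)
  refine Continuous.subtype_mk (f := fun θ : ℝ => NormedSpace.exp ((Complex.I * (θ / 2 : ℝ)) • H))
    ?_ _
  exact NormedSpace.exp_continuous.comp (by fun_prop)

theorem coe_hermRotation_of_mul_self (hH : H.IsHermitian) (h : H * H = 1) (θ : ℝ) :
    (hermRotation H hH θ : QMat n) =
      (Real.cos (θ / 2) : ℂ) • (1 : QMat n) + (Complex.I * Real.sin (θ / 2)) • H := by
  rw [coe_hermRotation]
  set t : ℂ := ((θ / 2 : ℝ) : ℂ) with ht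
  rw [Complex.ofReal_cos, Complex.ofReal_sin, ← ht]
  let _ : NormedAlgebra ℚ (QMat n) := NormedAlgebra.restrictScalars ℚ ℂ (QMat n)
  have hpow (k : ℕ) : H ^ (2 * k) = 1 := by rw [pow_mul, pow_two, h, one_pow]
  have hc := (Complex.hasSum_cos' t).smul_const (1 : QMat n)
  have hs := ((Complex.hasSum_sin' t).mul_left Complex.I).smul_const H
  -- As `H² = 1`, the even part of the exponential series is a cosine series times 1 and the odd
  -- part a sine series times `H`.
  have he := HasSum.even_add_odd
    (f := fun k : ℕ => ((Nat.factorial k : ℂ)⁻¹) • ((Complex.I * t) • H) ^ k)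
    (m := Complex.cos t • (1 : QMat n)) (m' := (Complex.I * Complex.sin t) • H) ?_ ?_
  · exact (NormedSpace.exp_series_hasSum_exp' (𝕂 := ℂ) ((Complex.I * t) • H)).unique he
  · convert hc using 2 with k
    rw [smul_pow, hpow, smul_smul]
    congr 1
    ring
  · convert hs using 2 with k
    rw [smul_pow, pow_succ H, hpow, one_mul, smul_smul]
    congr 1
    field_simp

/-- A closed subgroup containing a rotation about an involution by an angle incommensurable with
`π` contains all rotations about it. -/
theorem hermRotation_mem_of_irrational {K : Subgroup (QUnitary n)} (hK : IsClosed (K : Set (QUnitary n)))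
    (hH : H.IsHermitian) (h : H * H = 1) {φ : ℝ} (hφ : Irrational (φ / Real.pi))
    (hmem : hermRotation H hH (2 * φ) ∈ K) (θ : ℝ) : hermRotation H hH θ ∈ K := by
  let S : AddSubgroup ℝ :=
    { carrier := {t | hermRotation H hH t ∈ K}
      zero_mem' := by
        change hermRotation H hH 0 ∈ K
        rw [hermRotation_zero]
        exact K.one_mem
      add_mem' := fun {a b} ha hb => by
        change hermRotation H hH (a + b) ∈ K
        rw [hermRotation_add]
        exact K.mul_mem ha hb
      neg_mem' := fun {a} ha => by
        change hermRotation H hH (-a) ∈ K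
        rw [hermRotation_neg]
        exact K.inv_mem ha }
  have hS : IsClosed (S : Set ℝ) := hK.preimage (continuous_hermRotation hH)
  -- The half angle makes the period 4π; a turn by 2π is only -1.
  have hper : 4 * Real.pi ∈ S := by
    change hermRotation H hH _ ∈ K
    convert K.one_mem
    apply Subtype.ext
    rw [coe_hermRotation_of_mul_self hH h, show 4 * Real.pi / 2 = 2 * Real.pi by ring]
    simp
  have hd : Dense (AddSubgroup.closure {2 * φ, 4 * Real.pi} : Set ℝ) := by
    rw [dense_addSubgroupClosure_pair_iff]
    have := hφ.div_natCast (m := 2) (by norm_num)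
    convert this using 1
    push_cast
    field_simp
    ring
  have hle : AddSubgroup.closure {2 * φ, 4 * Real.pi} ≤ S := by
    rw [AddSubgroup.closure_le]
    rintro x (rfl | rfl)
    exacts [hmem, hper]
  have : (Set.univ : Set ℝ) ⊆ S := by
    rw [← hd.closure_eq]
    exact closure_minimal hle hS
  exact this (Set.mem_univ θ)

theorem norm_pow_sub_pow_le {E : Type*} [SeminormedRing E] [NormOneClass E] {x y : E}
    (hx : ‖x‖ ≤ 1) (hy : ‖y‖ ≤ 1) (k : ℕ) : ‖x ^ k - y ^ k‖ ≤ k * ‖x - y‖ := by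
  induction k with
  | zero => simp
  | succ k ih =>
    have e : x ^ (k + 1) - y ^ (k + 1) = x ^ k * (x - y) + (x ^ k - y ^ k) * y := by
      rw [pow_succ, pow_succ]; noncomm_ring
    rw [e]
    have h1 : ‖x ^ k * (x - y)‖ ≤ 1 * ‖x - y‖ :=
      (norm_mul_le _ _).trans (mul_le_mul_of_nonneg_right
        ((norm_pow_le _ _).trans (pow_le_one₀ (norm_nonneg _) hx)) (norm_nonneg _))
    have h2 : ‖(x ^ k - y ^ k) * y‖ ≤ k * ‖x - y‖ * 1 :=
      (norm_mul_le _ _).trans (mul_le_mul ih hy (norm_nonneg _) (by positivity))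
    push_cast
    linarith [norm_add_le (x ^ k * (x - y)) ((x ^ k - y ^ k) * y)]

theorem hermRotation_pow (hH : H.IsHermitian) (θ : ℝ) (k : ℕ) :
    hermRotation H hH θ ^ k = hermRotation H hH (k * θ) := by
  induction k with
  | zero => simp [hermRotation_zero]
  | succ k ih => rw [pow_succ, ih, ← hermRotation_add]; congr 1; push_cast; ring

/-- The Lie product formula for rotations. -/
theorem tendsto_hermRotation_mul_pow {A B : QMat n} (hA : A.IsHermitian) (hB : B.IsHermitian)
    (θ : ℝ) :
    Filter.Tendsto
      (fun k : ℕ => (hermRotation A hA (θ / k) * hermRotation B hB (θ / k)) ^ k)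
      Filter.atTop (nhds (hermRotation (A + B) (hA.add hB) θ)) := by
  set f : ℝ → QMat n := fun t => (hermRotation A hA t * hermRotation B hB t : QUnitary n) with hf
  set g : ℝ → QMat n := fun t => (hermRotation (A + B) (hA.add hB) t : QUnitary n) with hg
  -- The two curves agree to first order at 0, so they differ by o(1/k) at `θ / k`. Taking `k`-th
  -- powers of contractions costs only a factor `k`.
  have hd : HasDerivAt (fun t => f t - g t) 0 0 := by
    have h1 := (hasDerivAt_hermRotation_zero hA).mul (hasDerivAt_hermRotation_zero hB)
    have h2 := h1.sub (hasDerivAt_hermRotation_zero (hA.add hB))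
    rwa [hermRotation_zero, hermRotation_zero, OneMemClass.coe_one, mul_one, one_mul, ← smul_add,
      sub_self] at h2
  have h0 : f 0 - g 0 = 0 := by simp [hf, hg, hermRotation_zero]
  rw [hasDerivAt_iff_tendsto] at hd
  simp only [h0, sub_zero, smul_zero] at hd
  rw [tendsto_subtype_rng, tendsto_iff_norm_sub_tendsto_zero]
  have hlim : Filter.Tendsto (fun k : ℕ => θ / k) Filter.atTop (nhds 0) :=
    tendsto_const_div_atTop_nhds_zero_nat θ
  have h3 := (hd.comp hlim).const_mul |θ|
  rw [mul_zero] at h3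
  refine squeeze_zero' (Filter.Eventually.of_forall fun _ => norm_nonneg _) ?_ h3
  filter_upwards [Filter.eventually_gt_atTop 0] with k hk
  have hk' : (k : ℝ) ≠ 0 := by positivity
  have e : hermRotation (A + B) (hA.add hB) θ = hermRotation (A + B) (hA.add hB) (θ / k) ^ k := by
    rw [hermRotation_pow, mul_div_cancel₀ _ hk']
  rw [e]
  have hx (U : QUnitary n) : ‖(U : QMat n)‖ ≤ 1 := (CStarRing.norm_of_mem_unitary U.2).le
  have h4 := norm_pow_sub_pow_le (hx (hermRotation A hA (θ / k) * hermRotation B hB (θ / k)))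
    (hx (hermRotation (A + B) (hA.add hB) (θ / k))) k
  refine h4.trans ?_
  change (k : ℝ) * ‖f (θ / k) - g (θ / k)‖ ≤ _
  rcases eq_or_ne θ 0 with hθ | hθ
  · simp [hθ, h0]
  · simp only [Function.comp_apply, Real.norm_eq_abs, abs_div, Nat.abs_cast]
    have : |θ| ≠ 0 := abs_ne_zero.mpr hθ
    rw [inv_div, ← mul_assoc, mul_div_cancel₀ _ this]

theorem hermRotation_add_mem {K : Subgroup (QUnitary n)} (hK : IsClosed (K : Set (QUnitary n)))
    {A B : QMat n} (hA : A.IsHermitian) (hB : B.IsHermitian)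
    (hAK : ∀ θ, hermRotation A hA θ ∈ K) (hBK : ∀ θ, hermRotation B hB θ ∈ K) (θ : ℝ) :
    hermRotation (A + B) (hA.add hB) θ ∈ K :=
  hK.mem_of_tendsto (tendsto_hermRotation_mul_pow hA hB θ)
    (Filter.Eventually.of_forall fun _ => K.pow_mem (K.mul_mem (hAK _) (hBK _)) _)

end Rotation

end Matchgate

namespace Matchgate

/-! ### Rotations about two anticommuting involutions -/

section Anticommuting

/-- Twice the cosine of a rational multiple of π is an algebraic integer. Here it is 1 + √2/2;
subtracting 1 and squaring gives 1/2, which is not an integer. -/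
theorem irrational_arccos_cos_sq_pi_div_eight :
    Irrational (Real.arccos (Real.cos (Real.pi / 8) ^ 2) / Real.pi) := by
  rintro ⟨q, hq⟩
  have hq' : (q : ℝ) * Real.pi = Real.arccos (Real.cos (Real.pi / 8) ^ 2) := by
    rw [hq, div_mul_cancel₀ _ Real.pi_ne_zero]
  have h1 := Real.isIntegral_two_mul_cos_rat_mul_pi q
  have hc : Real.cos (Real.pi / 8) ^ 2 = 1 / 2 + √2 / 4 := by
    rw [Real.cos_sq, show 2 * (Real.pi / 8) = Real.pi / 4 by ring, Real.cos_pi_div_four]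
    ring
  rw [hq', Real.cos_arccos (by nlinarith) (Real.cos_sq_le_one _), hc] at h1
  have h2 := (h1.sub isIntegral_one).pow 2
  have e : (2 * (1 / 2 + √2 / 4) - 1) ^ 2 = (((1 / 2 : ℚ)) : ℝ) := by
    have := Real.sq_sqrt (show (0 : ℝ) ≤ 2 by norm_num)
    push_cast
    linear_combination this / 4
  rw [e] at h2
  obtain ⟨k, hk⟩ := h2.exists_int_iff_exists_rat.mp ⟨_, rfl⟩
  have hk' : (1 : ℝ) = 2 * k := by rw [← hk]; norm_num
  have : (1 : ℤ) = 2 * k := by exact_mod_cast hk'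
  omega

variable {n : ℕ} {A B : QMat n}

theorem isHermitian_I_smul_mul (hA : A.IsHermitian) (hB : B.IsHermitian) (hAB : B * A = -(A * B)) :
    (Complex.I • (A * B)).IsHermitian := by
  rw [Matrix.IsHermitian, Matrix.conjTranspose_smul, Matrix.conjTranspose_mul, hA.eq, hB.eq, hAB]
  simp

theorem isHermitian_ofReal_smul (hA : A.IsHermitian) (r : ℝ) : ((r : ℂ) • A).IsHermitian := by
  rw [Matrix.IsHermitian, Matrix.conjTranspose_smul, hA.eq]
  simp

/-- Conjugation by the product of quarter rotations about two anticommuting involutions carries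
the first involution to the second. -/
theorem hermRotation_mul_mul_eq (hA : A.IsHermitian) (hB : B.IsHermitian) (hA2 : A * A = 1)
    (hB2 : B * B = 1) (hAB : B * A = -(A * B)) :
    ((hermRotation A hA (Real.pi / 2) * hermRotation B hB (Real.pi / 2) : QUnitary n) : QMat n) * A
      = B * (hermRotation A hA (Real.pi / 2) * hermRotation B hB (Real.pi / 2) : QUnitary n) := by
  rw [Submonoid.coe_mul, coe_hermRotation_of_mul_self hA hA2, coe_hermRotation_of_mul_self hB hB2,
    show Real.pi / 2 / 2 = Real.pi / 4 by ring, Real.cos_pi_div_four, Real.sin_pi_div_four]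
  have hBAB : B * (A * B) = -A := by rw [← mul_assoc, hAB, neg_mul, mul_assoc, hB2, mul_one]
  have hI := Complex.I_sq
  simp only [add_mul, mul_add, smul_mul_assoc, mul_smul_comm, one_mul, mul_one, mul_assoc,
    hAB, hA2, hB2, hBAB, mul_neg, smul_neg]
  simp only [← mul_assoc, hA2, one_mul]
  -- Both sides are homogeneous of degree two in `w`, so its value is irrelevant.
  generalize ((√2 / 2 : ℝ) : ℂ) = w
  match_scalars <;>
    first
    | ring1
    | linear_combination w ^ 2 * hI
    | linear_combination -w ^ 2 * hI

theorem hermRotation_mem_of_anticommute {K : Subgroup (QUnitary n)}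
    (hK : IsClosed (K : Set (QUnitary n))) (hA : A.IsHermitian) (hB : B.IsHermitian)
    (hA2 : A * A = 1) (hB2 : B * B = 1) (hAB : B * A = -(A * B))
    (hAT : hermRotation A hA (Real.pi / 4) ∈ K) (hBS : hermRotation B hB (Real.pi / 2) ∈ K) :
    (∀ θ, hermRotation A hA θ ∈ K) ∧ ∀ θ, hermRotation B hB θ ∈ K := by
  have hAS : hermRotation A hA (Real.pi / 2) ∈ K := by
    rw [show Real.pi / 2 = Real.pi / 4 + Real.pi / 4 by ring, hermRotation_add]
    exact K.mul_mem hAT hAT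
  have hAZ : hermRotation A hA Real.pi ∈ K := by
    rw [show Real.pi = Real.pi / 2 + Real.pi / 2 by ring, hermRotation_add]
    exact K.mul_mem hAS hAS
  have hconj (θ : ℝ) (h : hermRotation A hA θ ∈ K) : hermRotation B hB θ ∈ K := by
    rw [← hermRotation_conj hA _ hB (hermRotation_mul_mul_eq hA hB hA2 hB2 hAB)]
    exact K.mul_mem (K.mul_mem (K.mul_mem hAS hBS) h) (K.inv_mem (K.mul_mem hAS hBS))
  have hBT := hconj _ hAT
  suffices h : ∀ θ, hermRotation A hA θ ∈ K from ⟨h, fun θ => hconj θ (h θ)⟩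
  set c : ℝ := Real.cos (Real.pi / 8) with hc
  set s : ℝ := Real.sin (Real.pi / 8) with hs
  have hcs : s ^ 2 + c ^ 2 = 1 := Real.sin_sq_add_cos_sq _
  have hc0 : 0 < c := Real.cos_pos_of_mem_Ioo ⟨by linarith [Real.pi_pos], by linarith [Real.pi_pos]⟩
  have hs0 : 0 < s := Real.sin_pos_of_pos_of_lt_pi (by positivity) (by linarith [Real.pi_pos])
  -- The product is (c + isA)(c + isB) = c² + ics(A + B) - s²AB. Matching it with cos φ + i sin φ
  -- `N` dictates `φ`, `α` and `β`.
  set φ : ℝ := Real.arccos (c ^ 2) with hφ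
  have hcφ : Real.cos φ = c ^ 2 := Real.cos_arccos (by nlinarith) (by nlinarith)
  have hsφ : Real.sin φ ^ 2 = s ^ 2 * (1 + c ^ 2) := by
    rw [Real.sin_sq, hcφ]
    linear_combination (-(1 + c ^ 2)) * hcs
  set σ := Real.sin φ with hσ
  have hσ0 : σ ≠ 0 := by
    intro h
    rw [h] at hsφ
    have : 0 < s ^ 2 * (1 + c ^ 2) := by positivity
    linarith
  set α : ℝ := c * s / σ with hα
  set β : ℝ := s ^ 2 / σ with hβ
  have hα0 : α ≠ 0 := by positivity
  have hσα : σ * α = c * s := by rw [hα]; field_simp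
  have hσβ : σ * β = s ^ 2 := by rw [hβ]; field_simp
  have hαβ : 2 * α ^ 2 + β ^ 2 = 1 := by
    rw [hα, hβ]
    field_simp
    rw [hsφ]
    linear_combination s ^ 2 * hcs
  have hBAB : B * (A * B) = -A := by rw [← mul_assoc, hAB, neg_mul, mul_assoc, hB2, mul_one]
  have hAAB : A * (A * B) = B := by rw [← mul_assoc, hA2, one_mul]
  have hC := isHermitian_I_smul_mul hA hB hAB
  set N : QMat n := (α : ℂ) • A + (α : ℂ) • B + (β : ℂ) • (Complex.I • (A * B)) with hN
  set N' : QMat n := (α : ℂ) • A + (-α : ℂ) • B + (-β : ℂ) • (Complex.I • (A * B)) with hN'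
  have hNH : N.IsHermitian :=
    ((isHermitian_ofReal_smul hA α).add (isHermitian_ofReal_smul hB α)).add
      (isHermitian_ofReal_smul hC β)
  have hN'H : N'.IsHermitian := by
    have := ((isHermitian_ofReal_smul hA α).add (isHermitian_ofReal_smul hB (-α))).add
      (isHermitian_ofReal_smul hC (-β))
    push_cast at this
    exact this
  have hI := Complex.I_sq
  have hαβC : 2 * (α : ℂ) ^ 2 + (β : ℂ) ^ 2 = 1 := by exact_mod_cast hαβ
  have hσαC : (σ : ℂ) * α = c * s := by exact_mod_cast hσα
  have hσβC : (σ : ℂ) * β = (s : ℂ) ^ 2 := by exact_mod_cast hσβ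
  have hN2 : N * N = 1 := by
    simp only [hN, add_mul, mul_add, smul_mul_assoc, mul_smul_comm, smul_smul, mul_assoc,
      hAB, hA2, hB2, hBAB, hAAB, mul_neg, smul_neg, mul_one]
    match_scalars <;>
      first
      | ring1
      | linear_combination hαβC - (β : ℂ) ^ 2 * hI
  have hW : hermRotation N hNH (2 * φ) =
      hermRotation A hA (Real.pi / 4) * hermRotation B hB (Real.pi / 4) := by
    apply Subtype.ext
    rw [Submonoid.coe_mul, coe_hermRotation_of_mul_self hA hA2, coe_hermRotation_of_mul_self hB hB2,
      coe_hermRotation_of_mul_self hNH hN2, show Real.pi / 4 / 2 = Real.pi / 8 by ring,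
      mul_div_cancel_left₀ _ two_ne_zero, hcφ, ← hc, ← hs, ← hσ]
    simp only [hN, add_mul, mul_add, smul_add, smul_mul_assoc, mul_smul_comm, smul_smul, one_mul,
      mul_one]
    push_cast
    match_scalars
    · ring
    · linear_combination Complex.I * hσαC
    · linear_combination Complex.I * hσαC
    · linear_combination Complex.I ^ 2 * hσβC
  have hNK : ∀ θ, hermRotation N hNH θ ∈ K :=
    hermRotation_mem_of_irrational hK hNH hN2 irrational_arccos_cos_sq_pi_div_eight
      (by rw [hW]; exact K.mul_mem hAT hBT)
  -- The half turn is `iA`; conjugation by it fixes `A` and negates `B` and `iAB`.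
  have hrel : (hermRotation A hA Real.pi : QMat n) * N = N' * hermRotation A hA Real.pi := by
    rw [coe_hermRotation_of_mul_self hA hA2, Real.cos_pi_div_two, Real.sin_pi_div_two]
    simp only [hN, hN', add_mul, mul_add, smul_mul_assoc, mul_smul_comm, smul_smul, mul_assoc,
      hAB, hA2, hAAB, mul_neg, smul_neg, Complex.ofReal_zero, zero_smul, zero_add]
    match_scalars <;> ring
  have hN'K (θ : ℝ) : hermRotation N' hN'H θ ∈ K := by
    rw [← hermRotation_conj hNH _ hN'H hrel]
    exact K.mul_mem (K.mul_mem hAZ (hNK θ)) (K.inv_mem hAZ)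
  have hsum : N + N' = ((2 * α : ℝ) : ℂ) • A := by
    rw [hN, hN']
    push_cast
    module
  intro θ
  have h := hermRotation_add_mem hK hNH hN'H hNK hN'K (θ / (2 * α))
  rwa [hermRotation_congr _ (hsum ▸ hNH.add hN'H) hsum, hermRotation_smul hA,
    mul_div_cancel₀ _ (by positivity)] at h

end Anticommuting

end Matchgate

namespace Matchgate

/-! ### Pauli strings and Clifford rotations -/

section Pauli

variable {n : ℕ}

theorem tensor_mul (A B : Fin n → Matrix (Fin 2) (Fin 2) ℂ) :
    tensor A * tensor B = tensor fun q => A q * B q := by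
  ext x y
  simp only [tensor, Matrix.mul_apply, Matrix.of_apply, ← Finset.prod_mul_distrib]
  exact (Fintype.prod_sum fun q j => A q (x q) j * B q j (y q)).symm

theorem tensor_one : tensor (fun _ : Fin n => (1 : Matrix (Fin 2) (Fin 2) ℂ)) = 1 := by
  ext x y
  simp only [tensor, Matrix.of_apply, Matrix.one_apply]
  by_cases h : x = y
  · simp [h]
  · rw [if_neg h]
    obtain ⟨q, hq⟩ := Function.ne_iff.mp h
    exact Finset.prod_eq_zero (Finset.mem_univ q) (if_neg hq)

theorem tensor_smul (c : Fin n → ℂ) (A : Fin n → Matrix (Fin 2) (Fin 2) ℂ) :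
    tensor (fun q => c q • A q) = (∏ q, c q) • tensor A := by
  ext x y
  simp [tensor, Finset.prod_mul_distrib]

theorem pauliX_mul_self : pauliX * pauliX = 1 := by
  ext i j
  fin_cases i <;> fin_cases j <;> simp [pauliX]

theorem pauliZ_mul_self : pauliZ * pauliZ = 1 := by
  ext i j
  fin_cases i <;> fin_cases j <;> simp [pauliZ]

theorem pauliX_mul_pauliZ : pauliX * pauliZ = -(pauliZ * pauliX) := by
  ext i j
  fin_cases i <;> fin_cases j <;> simp [pauliX, pauliZ]

theorem Zop_mul_self (q : Fin n) : Zop q * Zop q = 1 := by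
  rw [Zop, onQubit, tensor_mul, ← tensor_one]
  congr 1
  ext1 i
  by_cases h : i = q <;> simp [h, pauliZ_mul_self]

theorem XXop_mul_self (q r : Fin n) : XXop q r * XXop q r = 1 := by
  rw [XXop, tensor_mul, ← tensor_one]
  congr 1
  ext1 i
  by_cases h : i = q ∨ i = r <;> simp [h, pauliX_mul_self]

theorem XXop_mul_Zop {q r p : Fin n} (hp : p = q ∨ p = r) :
    XXop q r * Zop p = -(Zop p * XXop q r) := by
  -- Placing the sign on qubit `p` alone lets the identity be checked factor by factor.
  have e : (-1 : ℂ) = ∏ i, if i = p then (-1 : ℂ) else 1 := by simp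
  rw [← neg_one_smul ℂ (Zop p * XXop q r), Zop, onQubit, XXop, tensor_mul, tensor_mul, e,
    ← tensor_smul]
  congr 1
  ext1 i
  by_cases h : i = p
  · subst h
    simp [hp, pauliX_mul_pauliZ]
  · simp [h]

/-- The four single-qubit Pauli matrices, including the identity. -/
def IsPauli (P : Matrix (Fin 2) (Fin 2) ℂ) : Prop :=
  P = 1 ∨ P = pauliX ∨ P = pauliY ∨ P = pauliZ

theorem IsPauli.mul_comm_sign {P Q : Matrix (Fin 2) (Fin 2) ℂ} (hP : IsPauli P)
    (hQ : IsPauli Q) : ∃ k : ℕ, P * Q = (-1 : ℂ) ^ k • (Q * P) := by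
  have h0 (h : P * Q = Q * P) : ∃ k : ℕ, P * Q = (-1 : ℂ) ^ k • (Q * P) := ⟨0, by simp [h]⟩
  have h1 (h : P * Q = -(Q * P)) : ∃ k : ℕ, P * Q = (-1 : ℂ) ^ k • (Q * P) := ⟨1, by simp [h]⟩
  rcases hP with rfl | rfl | rfl | rfl <;> rcases hQ with rfl | rfl | rfl | rfl <;>
    first
    | exact h0 (by simp)
    | exact h1 (by ext i j; fin_cases i <;> fin_cases j <;> simp [pauliX, pauliY, pauliZ])

theorem IsPauli.exists_mul_eq {P Q : Matrix (Fin 2) (Fin 2) ℂ} (hP : IsPauli P)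
    (hQ : IsPauli Q) : ∃ (k : ℕ) (R : _), IsPauli R ∧ P * Q = Complex.I ^ k • R := by
  have hXX := pauliX_mul_self
  have hZZ := pauliZ_mul_self
  have hYY : pauliY * pauliY = 1 := by
    ext i j; fin_cases i <;> fin_cases j <;> simp [pauliY]
  have hXY : pauliX * pauliY = Complex.I ^ 1 • pauliZ := by
    ext i j; fin_cases i <;> fin_cases j <;> simp [pauliX, pauliY, pauliZ]
  have hYX : pauliY * pauliX = Complex.I ^ 3 • pauliZ := by
    ext i j; fin_cases i <;> fin_cases j <;> simp [pauliX, pauliY, pauliZ, Complex.I_pow_three]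
  have hYZ : pauliY * pauliZ = Complex.I ^ 1 • pauliX := by
    ext i j; fin_cases i <;> fin_cases j <;> simp [pauliX, pauliY, pauliZ]
  have hZY : pauliZ * pauliY = Complex.I ^ 3 • pauliX := by
    ext i j; fin_cases i <;> fin_cases j <;> simp [pauliX, pauliY, pauliZ, Complex.I_pow_three]
  have hZX : pauliZ * pauliX = Complex.I ^ 1 • pauliY := by
    ext i j; fin_cases i <;> fin_cases j <;> simp [pauliX, pauliY, pauliZ]
  have hXZ : pauliX * pauliZ = Complex.I ^ 3 • pauliY := by
    ext i j; fin_cases i <;> fin_cases j <;> simp [pauliX, pauliY, pauliZ, pow_succ]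
  have h1 : IsPauli 1 := Or.inl rfl
  have hX : IsPauli pauliX := Or.inr (Or.inl rfl)
  have hY : IsPauli pauliY := Or.inr (Or.inr (Or.inl rfl))
  have hZ : IsPauli pauliZ := Or.inr (Or.inr (Or.inr rfl))
  rcases hP with rfl | rfl | rfl | rfl
  · exact ⟨0, Q, hQ, by simp⟩
  · rcases hQ with rfl | rfl | rfl | rfl
    exacts [⟨0, _, hX, by simp⟩, ⟨0, _, h1, by simpa using hXX⟩, ⟨1, _, hZ, hXY⟩, ⟨3, _, hY, hXZ⟩]
  · rcases hQ with rfl | rfl | rfl | rfl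
    exacts [⟨0, _, hY, by simp⟩, ⟨3, _, hZ, hYX⟩, ⟨0, _, h1, by simpa using hYY⟩, ⟨1, _, hX, hYZ⟩]
  · rcases hQ with rfl | rfl | rfl | rfl
    exacts [⟨0, _, hZ, by simp⟩, ⟨1, _, hY, hZX⟩, ⟨3, _, hX, hZY⟩, ⟨0, _, h1, by simpa using hZZ⟩]

variable {P Q : Fin n → Matrix (Fin 2) (Fin 2) ℂ}

theorem tensor_mul_comm_or_anticomm (hP : ∀ q, IsPauli (P q)) (hQ : ∀ q, IsPauli (Q q)) :
    tensor P * tensor Q = tensor Q * tensor P ∨ tensor P * tensor Q = -(tensor Q * tensor P) := by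
  choose k hk using fun q => (hP q).mul_comm_sign (hQ q)
  have h : tensor P * tensor Q = (-1 : ℂ) ^ (∑ q, k q) • (tensor Q * tensor P) := by
    rw [tensor_mul, tensor_mul, ← Finset.prod_pow_eq_pow_sum, ← tensor_smul]
    exact congrArg tensor (funext hk)
  rcases neg_one_pow_eq_or ℂ (∑ q, k q) with h' | h' <;> rw [h'] at h
  · exact Or.inl (by rw [h, one_smul])
  · exact Or.inr (by rw [h, neg_one_smul])

theorem exists_tensor_mul_eq (hP : ∀ q, IsPauli (P q)) (hQ : ∀ q, IsPauli (Q q)) :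
    ∃ (k : ℕ) (R : Fin n → Matrix (Fin 2) (Fin 2) ℂ), (∀ q, IsPauli (R q)) ∧
      tensor P * tensor Q = Complex.I ^ k • tensor R := by
  choose k R hR hk using fun q => (hP q).exists_mul_eq (hQ q)
  refine ⟨∑ q, k q, R, hR, ?_⟩
  rw [tensor_mul, ← Finset.prod_pow_eq_pow_sum, ← tensor_smul]
  exact congrArg tensor (funext hk)

/-- A string `Q` commuting with `P` is fixed; an anticommuting one goes to `i^j P Q`. Allowing `i^j
= ±i` covers a rotation and its inverse. -/
theorem conj_mem_pauliGroup {U : QUnitary n} {w : ℂ} {j : ℕ} (hj : (Complex.I ^ j) ^ 2 = -1)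
    (hP : ∀ q, IsPauli (P q)) (hP2 : tensor P * tensor P = 1)
    (hU : (U : QMat n) = w • (1 + Complex.I ^ j • tensor P)) {V : QUnitary n}
    (hV : V ∈ pauliGroup n) : U * V * U⁻¹ ∈ pauliGroup n := by
  obtain ⟨k, Q, hQ, hVQ⟩ := hV
  have key (M : QMat n) (h : (U : QMat n) * V = M * U) : ((U * V * U⁻¹ : QUnitary n) : QMat n) = M := by
    change (U : QMat n) * V * star (U : QMat n) = M
    rw [h, mul_assoc, Unitary.mul_star_self_of_mem U.2, mul_one]
  rcases tensor_mul_comm_or_anticomm hP hQ with h | h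
  · refine ⟨k, Q, hQ, key _ ?_⟩
    rw [hVQ, hU]
    simp only [smul_mul_assoc, mul_smul_comm, add_mul, mul_add, one_mul, mul_one, h]
    module
  · obtain ⟨l, R, hR, hl⟩ := exists_tensor_mul_eq hP hQ
    refine ⟨j + k + l, R, hR, key _ ?_⟩
    have h' : tensor P * tensor Q * tensor P = -tensor Q := by
      rw [h, neg_mul, mul_assoc, hP2, mul_one]
    rw [hVQ, hU, pow_add, mul_smul, ← hl]
    simp only [smul_mul_assoc, mul_smul_comm, add_mul, mul_add, one_mul, mul_one, h']
    rw [pow_add]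
    match_scalars
    · linear_combination (w * Complex.I ^ k) * hj
    · ring

theorem hermRotation_tensor_mem_cliffordGroup (hP : ∀ q, IsPauli (P q))
    (hH : (tensor P).IsHermitian) (hP2 : tensor P * tensor P = 1) :
    hermRotation (tensor P) hH (Real.pi / 2) ∈ cliffordGroup n := by
  have h1 : (hermRotation (tensor P) hH (Real.pi / 2) : QMat n) =
      (√2 / 2 : ℝ) • (1 + Complex.I ^ 1 • tensor P) := by
    rw [coe_hermRotation_of_mul_self hH hP2, show Real.pi / 2 / 2 = Real.pi / 4 by ring,
      Real.cos_pi_div_four, Real.sin_pi_div_four, ← Complex.coe_smul]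
    module
  have h2 : (((hermRotation (tensor P) hH (Real.pi / 2))⁻¹ : QUnitary n) : QMat n) =
      (√2 / 2 : ℝ) • (1 + Complex.I ^ 3 • tensor P) := by
    rw [← hermRotation_neg, coe_hermRotation_of_mul_self hH hP2,
      show -(Real.pi / 2) / 2 = -(Real.pi / 4) by ring, Real.cos_neg, Real.sin_neg,
      Real.cos_pi_div_four, Real.sin_pi_div_four, ← Complex.coe_smul, Complex.I_pow_three]
    push_cast
    module
  rw [← Complex.coe_smul] at h1 h2
  -- Normalizing is an equivalence; the converse conjugates by the inverse.
  refine fun V => ⟨conj_mem_pauliGroup (by simp) hP hP2 h1, fun hV => ?_⟩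
  have := conj_mem_pauliGroup (by rw [Complex.I_pow_three]; simp) hP hP2 h2 hV
  simpa [mul_assoc] using this

theorem Rz_pi_div_two_mem_cliffordGroup (q : Fin n) : Rz q (Real.pi / 2) ∈ cliffordGroup n := by
  refine hermRotation_tensor_mem_cliffordGroup (fun i => ?_) (Zop_isHermitian q) (Zop_mul_self q)
  by_cases h : i = q <;> simp [h, IsPauli]

theorem Rxx_pi_div_two_mem_cliffordGroup (q r : Fin n) :
    Rxx q r (Real.pi / 2) ∈ cliffordGroup n := by
  refine hermRotation_tensor_mem_cliffordGroup (fun i => ?_) (XXop_isHermitian q r)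
    (XXop_mul_self q r)
  by_cases h : i = q ∨ i = r <;> simp [h, IsPauli]

end Pauli

/-! ### Density in the matchgate group -/

section Density

variable {n : ℕ}

theorem Rz_mem_matchgateGroup (q : Fin n) (θ : ℝ) : Rz q θ ∈ matchgateGroup n :=
  Subgroup.subset_closure (Or.inl ⟨q, θ, rfl⟩)

theorem Rxx_mem_matchgateGroup {q r : Fin n} (h : q.val + 1 = r.val) (θ : ℝ) :
    Rxx q r θ ∈ matchgateGroup n :=
  Subgroup.subset_closure (Or.inr ⟨q, r, θ, h, rfl⟩)

theorem closure_gateSet_le : Subgroup.closure (gateSet n) ≤ matchgateGroup n := by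
  rw [Subgroup.closure_le]
  rintro U (⟨q, rfl | rfl⟩ | ⟨q, r, h, rfl⟩)
  exacts [Rz_mem_matchgateGroup _ _, Rz_mem_matchgateGroup _ _, Rxx_mem_matchgateGroup h _]

theorem matchgateGroup_le_of_isClosed (hn : 2 ≤ n) {K : Subgroup (QUnitary n)}
    (hK : IsClosed (K : Set (QUnitary n))) (hG : gateSet n ⊆ K) : matchgateGroup n ≤ K := by
  have key {p q r : Fin n} (hqr : q.val + 1 = r.val) (hp : p = q ∨ p = r) :
      (∀ θ, Rz p θ ∈ K) ∧ ∀ θ, Rxx q r θ ∈ K :=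
    hermRotation_mem_of_anticommute hK (Zop_isHermitian p) (XXop_isHermitian q r) (Zop_mul_self p)
      (XXop_mul_self q r) (XXop_mul_Zop hp) (hG (Or.inl ⟨p, Or.inl rfl⟩))
      (hG (Or.inr ⟨q, r, hqr, rfl⟩))
  rw [matchgateGroup, Subgroup.closure_le]
  rintro U (⟨q, θ, rfl⟩ | ⟨q, r, θ, h, rfl⟩)
  · by_cases hq : q.val + 1 < n
    · exact (key (q := q) (r := ⟨q.val + 1, hq⟩) rfl (Or.inl rfl)).1 θ
    -- The last qubit has no right neighbour; `2 ≤ n` supplies a left one.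
    · have hq' := q.isLt
      exact (key (q := ⟨q.val - 1, by omega⟩) (r := q) (by simp only; omega) (Or.inr rfl)).1 θ
  · exact (key h (Or.inl rfl)).2 θ

theorem generatesDenseSubgroup_of_gateSet_subset (hn : 2 ≤ n) {G : Set (QUnitary n)}
    (hG : gateSet n ⊆ Subgroup.closure G) (hle : Subgroup.closure G ≤ matchgateGroup n) :
    GeneratesDenseSubgroup G (matchgateGroup n) := by
  refine ⟨hle, fun U hU ε hε => ?_⟩
  have hmem : U ∈ (Subgroup.closure G).topologicalClosure :=
    matchgateGroup_le_of_isClosed hn (Subgroup.isClosed_topologicalClosure _)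
      (hG.trans (Subgroup.le_topologicalClosure _)) hU
  obtain ⟨V, hV, hd⟩ := Metric.mem_closure_iff.mp hmem ε hε
  exact ⟨V, hV, by rwa [Subtype.dist_eq, dist_eq_norm] at hd⟩

end Density

end Matchgate

theorem theorem1 (n : ℕ) (hn : 2 ≤ n) :
    Matchgate.GeneratesDenseSubgroup (Matchgate.gateSet n) (Matchgate.matchgateGroup n) ∧
      Matchgate.GeneratesDenseSubgroup
        ((Matchgate.matchgateCliffordGroup n : Set (Matchgate.QUnitary n)) ∪
          {U | ∃ q : Fin n, U = Matchgate.Tbar q})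
        (Matchgate.matchgateGroup n) := by
  refine ⟨Matchgate.generatesDenseSubgroup_of_gateSet_subset hn Subgroup.subset_closure
    Matchgate.closure_gateSet_le, Matchgate.generatesDenseSubgroup_of_gateSet_subset hn ?_ ?_⟩
  · rintro U (⟨q, rfl | rfl⟩ | ⟨q, r, h, rfl⟩) <;> apply Subgroup.subset_closure
    · exact Or.inr ⟨q, rfl⟩
    · exact Or.inl ⟨Matchgate.Rz_mem_matchgateGroup _ _,
        Matchgate.Rz_pi_div_two_mem_cliffordGroup q⟩
    · exact Or.inl ⟨Matchgate.Rxx_mem_matchgateGroup h _,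
        Matchgate.Rxx_pi_div_two_mem_cliffordGroup q r⟩
  · rw [Subgroup.closure_le]
    rintro U (hU | ⟨q, rfl⟩)
    exacts [hU.1, Matchgate.Rz_mem_matchgateGroup _ _]
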